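/- Let $A$ and $U$ be complex Banach algebras (not necessarily unital), and let $\theta$ be a character of $A$, that is, a nonzero multiplicative linear functional $A\to\mathbb{C}$ (automatically continuous). The $\theta$-Lau product $A\ltimes_\theta U$ is the Banach algebra $A\times U$ with norm $\|(a,x)\|=\|a\|+\|x\|$ and multiplication \[(a,x)(b,y)=\bigl(ab,\ \theta(a)y+\theta(b)x+xy\bigr).\] For a Banach algebra $B$ and a Banach $B$-bimodule $X$, let $Z^1(B,X)$ be the space of continuous derivations $\delta:B\to X$ (continuous linear maps with $\delta(ab)=a\,\delta(b)+\delta(a)\,b$ for all $a,b\in B$), let $N^1(B,X)$ be the subspace of inner derivations $a\mapsto ax-xa$ with $x\in X$, and put $H^1(B,X)=Z^1(B,X)/N^1(B,X)$ and $H^1(B)=H^1(B,B)$. Regard $U$ as a Banach $A$-bimodule with the actions $ax=xa=\theta(a)x$ for $a\in A$, $x\in U$. Assume that every continuous derivation $D$ of $A\ltimes_\theta U$ into itself maps $\{0\}\times U$ into $\{0\}\times U$; equivalently, that the component $\tau_1:U\to A$ of $D$, given by letting $\tau_1(x)$ be the $A$-coordinate of $D((0,x))$, is zero. If $H^1(A,U)=(0)$,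 then there is an isomorphism of complex vector spaces \[H^1(A\ltimes_\theta U)\cong H^1(A)\times H^1(U).\] -/

import Mathlib

/-- A Banach `A`-bimodule structure on a complex normed space `X`: bounded bilinear actions
`left a x = a · x` and `right a x = x · a` satisfying the bimodule laws. -/
structure BanachBimodule (A X : Type*) [NonUnitalNormedRing A] [NormedSpace ℂ A]
    [NormedAddCommGroup X] [NormedSpace ℂ X] where
  left : A →L[ℂ] X →L[ℂ] X
  right : A →L[ℂ] X →L[ℂ] X
  left_mul : ∀ a b x, left (a * b) x = left a (left b x)
  right_mul : ∀ a b x, right (a * b) x = right b (right a x)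
  left_right : ∀ a b x, right b (left a x) = left a (right b x)

namespace BanachBimodule

section Cohomology

variable {A X : Type*} [NonUnitalNormedRing A] [NormedSpace ℂ A]
  [NormedAddCommGroup X] [NormedSpace ℂ X]

/-- The space `Z¹(A, X)` of continuous derivations `A → X`, that is, of continuous linear maps
with `δ (a b) = a · δ b + δ a · b`. -/
def Z1 (M : BanachBimodule A X) : Submodule ℂ (A →L[ℂ] X) where
  carrier := {δ | ∀ a b, δ (a * b) = M.left a (δ b) + M.right b (δ a)}
  zero_mem' := by intro a b; simp
  add_mem' := by
    intro δ ε hδ hε a b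
    have h1 := hδ a b
    have h2 := hε a b
    simp only [add_apply, map_add, h1, h2]
    abel
  smul_mem' := by
    intro c δ hδ a b
    have h1 := hδ a b
    simp only [smul_apply, map_smul, h1, smul_add]

/-- The linear map `x ↦ id_x`, where `id_x a = a · x - x · a`. -/
noncomputable def inner (M : BanachBimodule A X) : X →ₗ[ℂ] (A →L[ℂ] X) :=
  ((M.left - M.right).flip : X →L[ℂ] A →L[ℂ] X)

theorem inner_apply (M : BanachBimodule A X) (x : X) (a : A) :
    M.inner x a = M.left a x - M.right a x := rfl

/-- The space `N¹(A, X)` of inner derivations. -/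
noncomputable def N1 (M : BanachBimodule A X) : Submodule ℂ (A →L[ℂ] X) :=
  LinearMap.range M.inner

theorem N1_le_Z1 (M : BanachBimodule A X) : M.N1 ≤ M.Z1 := by
  rintro _ ⟨x, rfl⟩ a b
  simp only [inner_apply, M.left_mul, M.right_mul, map_sub, M.left_right]
  abel

/-- The first cohomology group `H¹(A, X) = Z¹(A, X) / N¹(A, X)`. -/
abbrev H1 (M : BanachBimodule A X) : Type _ :=
  M.Z1 ⧸ M.N1.submoduleOf M.Z1

end Cohomology

section Examples

variable (A : Type*) [NonUnitalNormedRing A] [NormedSpace ℂ A]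
  [IsScalarTower ℂ A A] [SMulCommClass ℂ A A]

/-- A Banach algebra as a Banach bimodule over itself. -/
noncomputable def regular : BanachBimodule A A where
  left := ContinuousLinearMap.mul ℂ A
  right := (ContinuousLinearMap.mul ℂ A).flip
  left_mul a b x := mul_assoc a b x
  right_mul a b x := (mul_assoc x a b).symm
  left_right a b x := mul_assoc a x b

end Examples

/-- The Banach `A`-bimodule `U_θ`: the space `U` with actions `a · x = x · a = θ(a) x`. -/
noncomputable def ofCharacter {A : Type*} [NonUnitalNormedRing A] [NormedSpace ℂ A]
    (θ : WeakDual.characterSpace ℂ A) (U : Type*) [NormedAddCommGroup U] [NormedSpace ℂ U] :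
    BanachBimodule A U where
  left := (WeakDual.toStrongDual (θ : WeakDual ℂ A)).smulRight (ContinuousLinearMap.id ℂ U)
  right := (WeakDual.toStrongDual (θ : WeakDual ℂ A)).smulRight (ContinuousLinearMap.id ℂ U)
  left_mul a b x := by
    change θ (a * b) • x = θ a • θ b • x
    rw [map_mul, mul_smul]
  right_mul a b x := by
    change θ (a * b) • x = θ b • θ a • x
    rw [map_mul, mul_comm, mul_smul]
  left_right a b x := by
    change θ b • θ a • x = θ a • θ b • x
    rw [smul_comm]

@[simp] theorem ofCharacter_left {A : Type*} [NonUnitalNormedRing A] [NormedSpace ℂ A]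
    (θ : WeakDual.characterSpace ℂ A) {U : Type*} [NormedAddCommGroup U] [NormedSpace ℂ U]
    (a : A) (x : U) : (ofCharacter θ U).left a x = θ a • x := rfl

@[simp] theorem ofCharacter_right {A : Type*} [NonUnitalNormedRing A] [NormedSpace ℂ A]
    (θ : WeakDual.characterSpace ℂ A) {U : Type*} [NormedAddCommGroup U] [NormedSpace ℂ U]
    (a : A) (x : U) : (ofCharacter θ U).right a x = θ a • x := rfl

end BanachBimodule

/-- Characters are contractive. -/
theorem norm_character_apply_le {A : Type*} [NonUnitalNormedRing A] [NormedSpace ℂ A]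
    (θ : WeakDual.characterSpace ℂ A) (a : A) : ‖θ a‖ ≤ ‖a‖ := by
  set f : A →L[ℂ] ℂ := WeakDual.toStrongDual (θ : WeakDual ℂ A) with hf
  have hfa : ∀ b, f b = θ b := fun _ => rfl
  have hle : ‖f‖ ≤ √‖f‖ := by
    refine f.opNorm_le_bound (Real.sqrt_nonneg _) fun b => ?_
    have h1 : ‖f b‖ ^ 2 ≤ ‖f‖ * ‖b‖ ^ 2 := by
      calc ‖f b‖ ^ 2 = ‖f (b * b)‖ := by rw [hfa, hfa, map_mul, norm_mul, sq]
        _ ≤ ‖f‖ * ‖b * b‖ := f.le_opNorm _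
        _ ≤ ‖f‖ * (‖b‖ * ‖b‖) := by gcongr; exact norm_mul_le b b
        _ = ‖f‖ * ‖b‖ ^ 2 := by ring
    refine abs_le_of_sq_le_sq' ?_ (by positivity) |>.2
    rw [mul_pow, Real.sq_sqrt (norm_nonneg f)]
    exact h1
  have hle1 : ‖f‖ ≤ 1 := by
    have h0 := Real.sq_sqrt (norm_nonneg f)
    by_contra h
    push Not at h
    nlinarith [Real.sqrt_nonneg ‖f‖]
  calc ‖θ a‖ = ‖f a‖ := rfl
    _ ≤ ‖f‖ * ‖a‖ := f.le_opNorm a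
    _ ≤ 1 * ‖a‖ := by gcongr
    _ = ‖a‖ := one_mul _

/-- The `θ`-Lau product `A ⋉_θ U`: the space `A × U` with the `ℓ¹`-norm and the multiplication
`(a, x) (b, y) = (a b, θ(a) y + θ(b) x + x y)`. -/
def LauProduct {A : Type*} [NonUnitalNormedRing A] [NormedSpace ℂ A]
    (_θ : WeakDual.characterSpace ℂ A) (U : Type*) : Type _ :=
  WithLp 1 (A × U)

namespace LauProduct

variable {A : Type*} [NonUnitalNormedRing A] [NormedSpace ℂ A]
  {θ : WeakDual.characterSpace ℂ A} {U : Type*}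

/-- The element `(a, x)`. -/
def mk (θ : WeakDual.characterSpace ℂ A) (a : A) (x : U) : LauProduct θ U :=
  WithLp.toLp 1 (a, x)

/-- The component in `A`. -/
def fst (z : LauProduct θ U) : A := (WithLp.ofLp z).1

/-- The component in `U`. -/
def snd (z : LauProduct θ U) : U := (WithLp.ofLp z).2

@[simp] theorem fst_mk (a : A) (x : U) : (mk θ a x).fst = a := rfl
@[simp] theorem snd_mk (a : A) (x : U) : (mk θ a x).snd = x := rfl

@[ext] theorem ext {z w : LauProduct θ U} (h1 : z.fst = w.fst) (h2 : z.snd = w.snd) : z = w :=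
  WithLp.ofLp_injective 1 (Prod.ext h1 h2)

variable [NonUnitalNormedRing U]

noncomputable instance : NormedAddCommGroup (LauProduct θ U) :=
  inferInstanceAs (NormedAddCommGroup (WithLp 1 (A × U)))

instance [CompleteSpace A] [CompleteSpace U] : CompleteSpace (LauProduct θ U) :=
  inferInstanceAs (CompleteSpace (WithLp 1 (A × U)))

@[simp] theorem fst_zero : (0 : LauProduct θ U).fst = 0 := rfl
@[simp] theorem snd_zero : (0 : LauProduct θ U).snd = 0 := rfl
@[simp] theorem fst_add (z w : LauProduct θ U) : (z + w).fst = z.fst + w.fst := rfl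
@[simp] theorem snd_add (z w : LauProduct θ U) : (z + w).snd = z.snd + w.snd := rfl
theorem norm_def (z : LauProduct θ U) : ‖z‖ = ‖z.fst‖ + ‖z.snd‖ :=
  WithLp.prod_norm_eq_of_L1 (α := A) (β := U) z

variable [NormedSpace ℂ U]

noncomputable instance : NormedSpace ℂ (LauProduct θ U) :=
  inferInstanceAs (NormedSpace ℂ (WithLp 1 (A × U)))

@[simp] theorem fst_smul (c : ℂ) (z : LauProduct θ U) : (c • z).fst = c • z.fst := rfl
@[simp] theorem snd_smul (c : ℂ) (z : LauProduct θ U) : (c • z).snd = c • z.snd := rfl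

noncomputable instance : Mul (LauProduct θ U) where
  mul z w := mk θ (z.fst * w.fst) (θ z.fst • w.snd + θ w.fst • z.snd + z.snd * w.snd)

@[simp] theorem fst_mul (z w : LauProduct θ U) : (z * w).fst = z.fst * w.fst := rfl
@[simp] theorem snd_mul (z w : LauProduct θ U) :
    (z * w).snd = θ z.fst • w.snd + θ w.fst • z.snd + z.snd * w.snd := rfl

variable [IsScalarTower ℂ U U] [SMulCommClass ℂ U U]

noncomputable instance : NonUnitalNormedRing (LauProduct θ U) where
  __ := (inferInstance : NormedAddCommGroup (LauProduct θ U))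
  mul := (· * ·)
  left_distrib z w v := by
    ext
    · exact mul_add _ _ _
    · simp only [snd_mul, snd_add, fst_add, map_add, smul_add, add_smul, mul_add]
      abel
  right_distrib z w v := by
    ext
    · exact add_mul _ _ _
    · simp only [snd_mul, snd_add, fst_add, map_add, smul_add, add_smul, add_mul]
      abel
  zero_mul z := by
    ext <;> simp
  mul_zero z := by
    ext <;> simp
  mul_assoc z w v := by
    ext
    · exact mul_assoc _ _ _
    · simp only [snd_mul, fst_mul, map_mul, smul_add, add_mul, mul_add, smul_smul, mul_assoc,
        smul_mul_assoc, mul_smul_comm]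
      rw [mul_comm (θ v.fst) (θ z.fst), mul_comm (θ v.fst) (θ w.fst)]
      abel
  norm_mul_le z w := by
    have h1 : ‖θ z.fst • w.snd‖ ≤ ‖z.fst‖ * ‖w.snd‖ := by
      rw [norm_smul]
      gcongr
      exact norm_character_apply_le θ _
    have h2 : ‖θ w.fst • z.snd‖ ≤ ‖w.fst‖ * ‖z.snd‖ := by
      rw [norm_smul]
      gcongr
      exact norm_character_apply_le θ _
    have h3 := norm_mul_le z.snd w.snd
    have h4 := norm_mul_le z.fst w.fst
    have h5 := norm_add₃_le (a := θ z.fst • w.snd) (b := θ w.fst • z.snd) (c := z.snd * w.snd)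
    change ‖z * w‖ ≤ ‖z‖ * ‖w‖
    rw [norm_def, norm_def, norm_def, fst_mul, snd_mul]
    linarith

variable [IsScalarTower ℂ A A] [SMulCommClass ℂ A A]

instance : IsScalarTower ℂ (LauProduct θ U) (LauProduct θ U) where
  smul_assoc c z w := by
    ext
    · exact smul_mul_assoc c z.fst w.fst
    · simp only [smul_eq_mul, snd_mul, fst_smul, snd_smul, map_smul, smul_add, smul_smul,
        smul_mul_assoc, mul_comm (θ w.fst) c]

instance : SMulCommClass ℂ (LauProduct θ U) (LauProduct θ U) where
  smul_comm c z w := by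
    ext
    · exact (mul_smul_comm c z.fst w.fst).symm
    · simp only [smul_eq_mul, snd_mul, fst_smul, snd_smul, map_smul, smul_add, smul_smul,
        mul_smul_comm, mul_comm (θ z.fst) c]

end LauProduct

/-! A continuous derivation `D` of `A ⋉_θ U` is a 2×2 matrix of maps between `A` and `U`. The entry
`U → A` is zero by `hτ`. The entry `A → U` is a derivation into `U_θ`, whose two actions coincide;
inner derivations into `U_θ` therefore vanish, so `H¹(A, U) = 0` forces `Z¹(A, U) = 0` and this
entry is zero too. Thus `D` is diagonal, with entries derivations of `A` and `U`. Conversely, a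
diagonal pair `(δ, τ)` is a derivation because the only obstruction, the terms `θ (δ a) • x`,
vanishes (`character_apply_smul_eq_zero`). The `θ`-terms cancel in commutators, so inner derivations
correspond to pairs of inner ones (`mem_N1_lauProduct_iff`), and the isomorphism passes to
quotients. -/

namespace LauProduct

variable {A : Type*} [NonUnitalNormedRing A] [NormedSpace ℂ A]
  {θ : WeakDual.characterSpace ℂ A} {U : Type*} [NonUnitalNormedRing U]

@[simp] theorem fst_sub (z w : LauProduct θ U) : (z - w).fst = z.fst - w.fst := rfl
@[simp] theorem snd_sub (z w : LauProduct θ U) : (z - w).snd = z.snd - w.snd := rfl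

theorem mk_eq_add (a : A) (x : U) : mk θ a x = mk θ a 0 + mk θ 0 x := by
  ext <;> simp

variable [NormedSpace ℂ U]

theorem mk_zero_mul_mk_zero (a b : A) : mk θ a (0 : U) * mk θ b 0 = mk θ (a * b) 0 := by
  ext <;> simp

theorem mk_mul_mk_of_fst_zero (x y : U) : mk θ 0 x * mk θ 0 y = mk θ 0 (x * y) := by
  ext <;> simp

/-- The projection `A ⋉_θ U → A`. -/
noncomputable def fstCLM (θ : WeakDual.characterSpace ℂ A) (U : Type*) [NonUnitalNormedRing U]
    [NormedSpace ℂ U] : LauProduct θ U →L[ℂ] A :=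
  LinearMap.mkContinuous
    { toFun := fst
      map_add' := fst_add
      map_smul' := fst_smul } 1 fun z => by
    rw [one_mul, norm_def]
    exact le_add_of_nonneg_right (norm_nonneg _)

/-- The projection `A ⋉_θ U → U`. -/
noncomputable def sndCLM (θ : WeakDual.characterSpace ℂ A) (U : Type*) [NonUnitalNormedRing U]
    [NormedSpace ℂ U] : LauProduct θ U →L[ℂ] U :=
  LinearMap.mkContinuous
    { toFun := snd
      map_add' := snd_add
      map_smul' := snd_smul } 1 fun z => by
    rw [one_mul, norm_def]
    exact le_add_of_nonneg_left (norm_nonneg _)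

/-- The inclusion `A → A ⋉_θ U`, `a ↦ (a, 0)`. -/
noncomputable def inlCLM (θ : WeakDual.characterSpace ℂ A) (U : Type*) [NonUnitalNormedRing U]
    [NormedSpace ℂ U] : A →L[ℂ] LauProduct θ U :=
  LinearMap.mkContinuous
    { toFun := fun a => mk θ a 0
      map_add' := fun a b => by ext <;> simp
      map_smul' := fun c a => by ext <;> simp } 1 fun a => by
    simp [norm_def]

/-- The inclusion `U → A ⋉_θ U`, `x ↦ (0, x)`. -/
noncomputable def inrCLM (θ : WeakDual.characterSpace ℂ A) (U : Type*) [NonUnitalNormedRing U]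
    [NormedSpace ℂ U] : U →L[ℂ] LauProduct θ U :=
  LinearMap.mkContinuous
    { toFun := fun x => mk θ 0 x
      map_add' := fun x y => by ext <;> simp
      map_smul' := fun c x => by ext <;> simp } 1 fun x => by
    simp [norm_def]

@[simp] theorem fstCLM_apply (z : LauProduct θ U) : fstCLM θ U z = z.fst := rfl
@[simp] theorem sndCLM_apply (z : LauProduct θ U) : sndCLM θ U z = z.snd := rfl
@[simp] theorem inlCLM_apply (a : A) : inlCLM θ U a = mk θ a 0 := rfl
@[simp] theorem inrCLM_apply (x : U) : inrCLM θ U x = mk θ 0 x := rfl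

end LauProduct

namespace BanachBimodule

open LauProduct

section

variable {A : Type*} [NonUnitalNormedRing A] [NormedSpace ℂ A]
  [IsScalarTower ℂ A A] [SMulCommClass ℂ A A]

theorem mem_Z1_regular {D : A →L[ℂ] A} :
    D ∈ (regular A).Z1 ↔ ∀ a b, D (a * b) = a * D b + D a * b :=
  Iff.rfl

theorem regular_inner_apply (x a : A) : (regular A).inner x a = a * x - x * a := rfl

end

/-! ### Derivations from `A` into `U_θ` -/

variable {A : Type*} [NonUnitalNormedRing A] [NormedSpace ℂ A]
  {θ : WeakDual.characterSpace ℂ A} {U : Type*}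

/-- The actions on `U_θ` agree, so every inner derivation into `U_θ` vanishes. -/
theorem N1_ofCharacter [NormedAddCommGroup U] [NormedSpace ℂ U] : (ofCharacter θ U).N1 = ⊥ := by
  refine LinearMap.range_eq_bot.2 (LinearMap.ext fun x => ContinuousLinearMap.ext fun a => ?_)
  rw [inner_apply, ofCharacter_left, ofCharacter_right, sub_self]
  rfl

theorem Z1_ofCharacter_eq_bot [NormedAddCommGroup U] [NormedSpace ℂ U]
    (hH : Subsingleton (ofCharacter θ U).H1) : (ofCharacter θ U).Z1 = ⊥ := by
  rw [Submodule.Quotient.subsingleton_iff, Submodule.submoduleOf_eq_top, N1_ofCharacter] at hH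
  exact le_bot_iff.1 hH

/-- If `U_θ` is nonzero and has no nonzero derivations from `A`, then `θ` vanishes on the range of
every continuous derivation of `A`, because `a ↦ θ (δ a) x` is a derivation into `U_θ`. -/
theorem character_apply_smul_eq_zero [IsScalarTower ℂ A A] [SMulCommClass ℂ A A]
    [NormedAddCommGroup U] [NormedSpace ℂ U] (hZ : (ofCharacter θ U).Z1 = ⊥)
    {δ : A →L[ℂ] A} (hδ : δ ∈ (regular A).Z1) (a : A) (x : U) : θ (δ a) • x = 0 := by
  let f : A →L[ℂ] U :=
    ((WeakDual.toStrongDual (θ : WeakDual ℂ A)).comp δ).smulRight x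
  have hf : ∀ b, f b = θ (δ b) • x := fun _ => rfl
  have hmem : f ∈ (ofCharacter θ U).Z1 := by
    intro b c
    rw [ofCharacter_left, ofCharacter_right, hf, hf, hf, mem_Z1_regular.1 hδ, map_add, map_mul,
      map_mul, add_smul, mul_smul, mul_comm, mul_smul]
  rw [hZ, Submodule.mem_bot] at hmem
  rw [← hf, hmem]
  rfl

variable [NonUnitalNormedRing U] [NormedSpace ℂ U]
  [IsScalarTower ℂ A A] [SMulCommClass ℂ A A] [IsScalarTower ℂ U U] [SMulCommClass ℂ U U]

/-! ### Matrix entries of a derivation of `A ⋉_θ U` -/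

theorem fst_comp_inl_mem_Z1 {D : LauProduct θ U →L[ℂ] LauProduct θ U}
    (hD : D ∈ (regular (LauProduct θ U)).Z1) :
    (fstCLM θ U).comp (D.comp (inlCLM θ U)) ∈ (regular A).Z1 := by
  rw [mem_Z1_regular] at hD ⊢
  intro a b
  simpa [mk_zero_mul_mk_zero] using congrArg fst (hD (LauProduct.mk θ a 0) (LauProduct.mk θ b 0))

theorem snd_comp_inl_mem_Z1 {D : LauProduct θ U →L[ℂ] LauProduct θ U}
    (hD : D ∈ (regular (LauProduct θ U)).Z1) :
    (sndCLM θ U).comp (D.comp (inlCLM θ U)) ∈ (ofCharacter θ U).Z1 := by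
  rw [mem_Z1_regular] at hD
  intro a b
  simpa [mk_zero_mul_mk_zero] using congrArg snd (hD (LauProduct.mk θ a 0) (LauProduct.mk θ b 0))

/-- In the `U`-coordinate, the Leibniz rule on `(0, x) (0, y)` carries extra terms in which `θ` is
applied to the `U → A` entry; `hτ` removes them. -/
theorem snd_comp_inr_mem_Z1 {D : LauProduct θ U →L[ℂ] LauProduct θ U}
    (hD : D ∈ (regular (LauProduct θ U)).Z1) (hτ : ∀ x, (D (LauProduct.mk θ 0 x)).fst = 0) :
    (sndCLM θ U).comp (D.comp (inrCLM θ U)) ∈ (regular U).Z1 := by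
  rw [mem_Z1_regular] at hD ⊢
  intro x y
  simpa [mk_mul_mk_of_fst_zero, hτ] using
    congrArg snd (hD (LauProduct.mk θ 0 x) (LauProduct.mk θ 0 y))

/-- The pair of diagonal components of a derivation of `A ⋉_θ U` that preserves `U`. -/
noncomputable def diagonalComponents
    (hτ : ∀ D ∈ (regular (LauProduct θ U)).Z1, ∀ x : U, (D (LauProduct.mk θ 0 x)).fst = 0) :
    (regular (LauProduct θ U)).Z1 →ₗ[ℂ] (regular A).Z1 × (regular U).Z1 where
  toFun D := (⟨_, fst_comp_inl_mem_Z1 D.2⟩, ⟨_, snd_comp_inr_mem_Z1 D.2 (hτ D D.2)⟩)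
  map_add' _ _ := rfl
  map_smul' _ _ := rfl

theorem diagonalComponents_surjective
    (hτ : ∀ D ∈ (regular (LauProduct θ U)).Z1, ∀ x : U, (D (LauProduct.mk θ 0 x)).fst = 0)
    (hZ : (ofCharacter θ U).Z1 = ⊥) : Function.Surjective (diagonalComponents hτ) := by
  rintro ⟨⟨δ, hδ⟩, ⟨τ, h⟩⟩
  have hD : (inlCLM θ U).comp (δ.comp (fstCLM θ U)) + (inrCLM θ U).comp (τ.comp (sndCLM θ U)) ∈
      (regular (LauProduct θ U)).Z1 := by
    rw [mem_Z1_regular]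
    intro z w
    ext
    · simp [mem_Z1_regular.1 hδ]
    -- The diagonal map fails the Leibniz rule only by `θ (δ z.fst) • w.snd + θ (δ w.fst) • z.snd`,
    -- which is zero.
    · simp [mem_Z1_regular.1 h, character_apply_smul_eq_zero hZ hδ]
      abel
  exact ⟨⟨_, hD⟩, Prod.ext
    (Subtype.ext <| ContinuousLinearMap.ext fun a => add_zero (δ a))
    (Subtype.ext <| ContinuousLinearMap.ext fun x => zero_add (τ x))⟩

/-- Both off-diagonal entries vanish, one by `hτ` and the other by `hZ`. -/
theorem apply_eq_mk {D : LauProduct θ U →L[ℂ] LauProduct θ U}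
    (hD : D ∈ (regular (LauProduct θ U)).Z1) (hτ : ∀ x, (D (LauProduct.mk θ 0 x)).fst = 0)
    (hZ : (ofCharacter θ U).Z1 = ⊥) (z : LauProduct θ U) :
    D z = LauProduct.mk θ (D (LauProduct.mk θ z.fst 0)).fst (D (LauProduct.mk θ 0 z.snd)).snd := by
  have h0 := snd_comp_inl_mem_Z1 hD
  rw [hZ, Submodule.mem_bot] at h0
  have h1 : (D (LauProduct.mk θ z.fst 0)).snd = 0 := DFunLike.congr_fun h0 z.fst
  have h2 : z = LauProduct.mk θ z.fst 0 + LauProduct.mk θ 0 z.snd := mk_eq_add _ _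
  conv_lhs => rw [h2, map_add]
  ext <;> simp [hτ, h1]

theorem mem_N1_lauProduct_iff {D : LauProduct θ U →L[ℂ] LauProduct θ U}
    (hD : D ∈ (regular (LauProduct θ U)).Z1) (hτ : ∀ x, (D (LauProduct.mk θ 0 x)).fst = 0)
    (hZ : (ofCharacter θ U).Z1 = ⊥) :
    D ∈ (regular (LauProduct θ U)).N1 ↔
      (fstCLM θ U).comp (D.comp (inlCLM θ U)) ∈ (regular A).N1 ∧
        (sndCLM θ U).comp (D.comp (inrCLM θ U)) ∈ (regular U).N1 := by
  constructor
  · rintro ⟨w, rfl⟩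
    refine ⟨⟨w.fst, ContinuousLinearMap.ext fun a => ?_⟩,
      ⟨w.snd, ContinuousLinearMap.ext fun x => ?_⟩⟩ <;> simp [regular_inner_apply]
  · rintro ⟨⟨b, hb⟩, ⟨y, hy⟩⟩
    refine ⟨LauProduct.mk θ b y, ContinuousLinearMap.ext fun z => ?_⟩
    have h1 : z.fst * b - b * z.fst = (D (LauProduct.mk θ z.fst 0)).fst :=
      DFunLike.congr_fun hb z.fst
    have h2 : z.snd * y - y * z.snd = (D (LauProduct.mk θ 0 z.snd)).snd :=
      DFunLike.congr_fun hy z.snd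
    rw [apply_eq_mk hD hτ hZ, ← h1, ← h2, regular_inner_apply]
    ext
    · simp
    · simp
      -- The scalar terms `θ z.fst • y` and `θ b • z.snd` occur in both products, so they cancel in
      -- the commutator.
      abel

end BanachBimodule

open BanachBimodule in
theorem mainTheorem12
    {A : Type*} [NonUnitalNormedRing A] [NormedSpace ℂ A] [IsScalarTower ℂ A A]
    [SMulCommClass ℂ A A] [CompleteSpace A]
    {U : Type*} [NonUnitalNormedRing U] [NormedSpace ℂ U] [IsScalarTower ℂ U U]
    [SMulCommClass ℂ U U] [CompleteSpace U]
    (θ : WeakDual.characterSpace ℂ A)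
    (hτ : ∀ D ∈ (BanachBimodule.regular (LauProduct θ U)).Z1,
      ∀ x : U, (D (LauProduct.mk θ 0 x)).fst = 0)
    (hH : Subsingleton (BanachBimodule.ofCharacter θ U).H1) :
    Nonempty ((BanachBimodule.regular (LauProduct θ U)).H1 ≃ₗ[ℂ]
      (BanachBimodule.regular A).H1 × (BanachBimodule.regular U).H1) := by
  have hZ := Z1_ofCharacter_eq_bot hH
  let Φ : (regular (LauProduct θ U)).Z1 →ₗ[ℂ] (regular A).H1 × (regular U).H1 :=
    (LinearMap.prodMap (Submodule.mkQ _) (Submodule.mkQ _)).comp (diagonalComponents hτ)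
  have hsurj : Function.Surjective Φ :=
    ((Submodule.mkQ_surjective _).prodMap (Submodule.mkQ_surjective _)).comp
      (diagonalComponents_surjective hτ hZ)
  -- Inner derivations are exactly those whose diagonal entries both die in cohomology, so the first
  -- isomorphism theorem applies to `Φ`.
  have hker : (regular (LauProduct θ U)).N1.submoduleOf (regular (LauProduct θ U)).Z1 =
      LinearMap.ker Φ := by
    rw [LinearMap.ker_comp, LinearMap.ker_prodMap, Submodule.ker_mkQ, Submodule.ker_mkQ]
    ext D
    exact mem_N1_lauProduct_iff D.2 (hτ D D.2) hZ
  exact ⟨(Submodule.quotEquivOfEq _ _ hker).trans (Φ.quotKerEquivOfSurjective hsurj)⟩
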